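/- **Conventions.** A *form* over a category $\mathbb C$ is a faithful amnestic functor $F\colon\mathbb B\to\mathbb C$ (amnestic: the only isomorphisms mapped to identity morphisms are the identity morphisms). The $F$-*clusters* in an object $X$ are the objects of $\mathbb B$ mapped to $X$. For $f\colon X\to Y$ and clusters $S$ in $X$, $T$ in $Y$, write $T\ge_f S$ if there is a morphism $S\to T$ in $\mathbb B$ mapped to $f$; clusters in $X$ are ordered by $\ge\;=\;\ge_{1_X}$. The form is *orean* if (O1) the clusters in each object form a bounded lattice, (O2) $C\ge_{gf}A$ implies $C\ge_g B\ge_f A$ for some cluster $B$, and (O3) for all $f\colon X\to Y$, $S$, $T$ the direct image $f\cdot S=\min\{T'\mid T'\ge_f S\}$ and the inverse image $T\cdot f=\max\{S'\mid T\ge_f S'\}$ exist. Put $\operatorname{Im}f=f\cdot\top$ and $\operatorname{Ker}f=\bot\cdot f$. An orean form is *conormal* (*normal*) if every cluster is an image (a kernel) of some morphism. An *embedding* of a cluster $S$ in $X$ is a morphism $\iota_S$ into $X$ with image $S$ through which every morphism with image $\le S$ factors uniquely; dually, a *quotient* of $S$ is a morphism $\pi_S$ from $X$ with kernel $S$ through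 which every morphism with kernel $\ge S$ factors uniquely. A *projection* is a quotient of some cluster. An orean form satisfies (N1) if $(f\cdot S)\cdot f=S\vee\operatorname{Ker}f$ and $f\cdot(T\cdot f)=T\wedge\operatorname{Im}f$ for all $f\colon X\to Y$ and all clusters $S$ in $X$, $T$ in $Y$. An *operator* $F\to G$ between forms $F,G$ over $\mathbb C$ is a functor between their domains commuting with $F$ and $G$; between orean forms it is *conormal* (*normal*) if it preserves images (kernels) of morphisms. An *orean factorization* of $\mathbb C$ is a pair $(F_s,F_e)$, where $F_s$ is a conormal orean form and $F_e$ a normal orean form over $\mathbb C$, such that every morphism $f$ is a composite $f=m\circ e$ of an $F_e$-quotient $e$ of the $F_e$-kernel $\operatorname{Ker}^e f$ and an $F_s$-embedding $m$ of the $F_s$-image $\operatorname{Im}^s f$. Superscripts $s,e$ refer to $F_s,F_e$. Then there is a unique conormal operator $\alpha\colon F_s\to F_e$, given by $\alpha(A)=\operatorname{Im}^e\iota^s_A$, and a unique normal operator $\beta\colon F_e\to F_s$, given by $\beta(R)=\operatorname{Ker}^s\pi^e_R$. For an $F_s$-cluster $A$ and an $F_e$-cluster $R$ in the same object, put $A\ast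 R=(\pi^e_R\cdot^s A)\cdot^s\pi^e_R$. **Theorem.** Let $(F_s,F_e)$ be an orean factorization of a category $\mathbb C$. Then the conditions (i) and (ii) below hold together if and only if the conditions (i$'$) and (ii$'$) hold together. * (i) $F_e$ satisfies (N1), and for every morphism $f\colon X\to Y$, every $F_s$-cluster $A$ in $Y$ and every $F_e$-cluster $R$ in $Y$ such that $A\ast R=A$, $R\ge\alpha(A)$, $\operatorname{Im}^s f\ge A$ and $\operatorname{Im}^e f\ge R$, we have $(f\cdot^s(A\cdot^s f))\ast R=A$. * (ii) $\alpha$ preserves binary meets; $A=A\ast\alpha(A)$ for every $F_s$-cluster $A$; and $R\ge\alpha(\beta(R))$ for every $F_e$-cluster $R$. * (i$'$) $F_e$ satisfies (N1), and for every $F_e$-projection $e$ and every $F_s$-cluster $A$ in the codomain of $e$, we have $(e\cdot^s(A\cdot^s e))\ast\alpha(A)=A\ast\alpha(A)=A$. * (ii$'$) $\alpha$ preserves binary meets and bottom clusters. -/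

import Mathlib

open CategoryTheory

universe v₁ v₂ v₃ u₁ u₂ u₃

namespace OreanForms

/-- A *form* over `C`: a faithful amnestic functor into `C`. Amnestic means that the only
isomorphisms sent to identity morphisms are the identity morphisms. -/
class Form {B : Type u₂} [Category.{v₂} B] {C : Type u₁} [Category.{v₁} C] (F : B ⥤ C) :
    Prop extends F.Faithful where
  amnestic : ∀ {A A' : B} (i : A ≅ A'), F.IsHomLift (𝟙 (F.obj A)) i.hom →
    ∃ h : A = A', i.hom = eqToHom h

section Forms

variable {C : Type u₁} [Category.{v₁} C] {B : Type u₂} [Category.{v₂} B]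

/-- The clusters in an object `X` for `F`: the objects of the domain lying over `X`. -/
def Cluster (F : B ⥤ C) (X : C) : Type u₂ := {S : B // F.obj S = X}

/-- `Rel F f S T` is the relation `T ≥_f S`: there is a morphism `S ⟶ T` lying over `f`. -/
def Rel (F : B ⥤ C) {X Y : C} (f : X ⟶ Y) (S : Cluster F X) (T : Cluster F Y) : Prop :=
  ∃ φ : S.1 ⟶ T.1, F.IsHomLift f φ

theorem Rel.comp {F : B ⥤ C} {X Y Z : C} {f : X ⟶ Y} {g : Y ⟶ Z} {S : Cluster F X}
    {T : Cluster F Y} {U : Cluster F Z} (h₁ : Rel F f S T) (h₂ : Rel F g T U) :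
    Rel F (f ≫ g) S U := by
  obtain ⟨φ, hφ⟩ := h₁
  obtain ⟨ψ, hψ⟩ := h₂
  exact ⟨φ ≫ ψ, inferInstance⟩

theorem Rel.refl {F : B ⥤ C} {X : C} (S : Cluster F X) : Rel F (𝟙 X) S S :=
  ⟨𝟙 _, IsHomLift.id S.2⟩

theorem lift_unique {F : B ⥤ C} [F.Faithful] {X Y : C} {f : X ⟶ Y} {S T : B} {φ ψ : S ⟶ T}
    (h₁ : F.IsHomLift f φ) (h₂ : F.IsHomLift f ψ) : φ = ψ := by
  apply F.map_injective
  rw [IsHomLift.fac' F f φ, IsHomLift.fac' F f ψ]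

/-- The order of clusters in `X`: `S ≤ T` means `T ≥_f S` for `f` the identity of `X`. -/
instance (F : B ⥤ C) [Form F] (X : C) : PartialOrder (Cluster F X) where
  le S T := Rel F (𝟙 X) S T
  le_refl S := Rel.refl S
  le_trans S T U h₁ h₂ := by
    have h := Rel.comp h₁ h₂
    rwa [Category.comp_id] at h
  le_antisymm S T h₁ h₂ := by
    obtain ⟨S, rfl⟩ := S
    obtain ⟨T, hT⟩ := T
    obtain ⟨φ, hφ⟩ := h₁
    obtain ⟨ψ, hψ⟩ := h₂
    obtain ⟨h, -⟩ := Form.amnestic (F := F)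
      { hom := φ
        inv := ψ
        hom_inv_id := lift_unique (IsHomLift.comp_of_lift_id F _ φ ψ) (IsHomLift.id rfl)
        inv_hom_id := lift_unique (IsHomLift.comp_of_lift_id F _ ψ φ) (IsHomLift.id hT) } hφ
    exact Subtype.ext h

/-- An *orean form*: (O1) the clusters in each object form a bounded lattice; (O2) relations over
a composite factorize; (O3) direct and inverse images of clusters exist. -/
class OreanForm (F : B ⥤ C) : Prop extends Form F where
  exists_top : ∀ X : C, ∃ T : Cluster F X, ∀ S, S ≤ T
  exists_bot : ∀ X : C, ∃ T : Cluster F X, ∀ S, T ≤ S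
  exists_sup : ∀ {X : C} (S T : Cluster F X), ∃ U, IsLUB {S, T} U
  exists_inf : ∀ {X : C} (S T : Cluster F X), ∃ U, IsGLB {S, T} U
  exists_factor : ∀ {X Y Z : C} (f : X ⟶ Y) (g : Y ⟶ Z) (S : Cluster F X) (U : Cluster F Z),
    Rel F (f ≫ g) S U → ∃ T : Cluster F Y, Rel F f S T ∧ Rel F g T U
  exists_direct : ∀ {X Y : C} (f : X ⟶ Y) (S : Cluster F X),
    ∃ T, IsLeast {T : Cluster F Y | Rel F f S T} T
  exists_inverse : ∀ {X Y : C} (f : X ⟶ Y) (T : Cluster F Y),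
    ∃ S, IsGreatest {S : Cluster F X | Rel F f S T} S

noncomputable section

/-- The lattice structure on clusters in `X` given by (O1). -/
instance (F : B ⥤ C) [OreanForm F] (X : C) : Lattice (Cluster F X) where
  sup S T := (OreanForm.exists_sup S T).choose
  le_sup_left S T := (OreanForm.exists_sup S T).choose_spec.1 (by simp)
  le_sup_right S T := (OreanForm.exists_sup S T).choose_spec.1 (by simp)
  sup_le S T U h₁ h₂ := (OreanForm.exists_sup S T).choose_spec.2 (by
    rintro V (rfl | rfl) <;> assumption)
  inf S T := (OreanForm.exists_inf S T).choose
  inf_le_left S T := (OreanForm.exists_inf S T).choose_spec.1 (by simp)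
  inf_le_right S T := (OreanForm.exists_inf S T).choose_spec.1 (by simp)
  le_inf U S T h₁ h₂ := (OreanForm.exists_inf S T).choose_spec.2 (by
    rintro V (rfl | rfl) <;> assumption)

instance (F : B ⥤ C) [OreanForm F] (X : C) : BoundedOrder (Cluster F X) where
  top := (OreanForm.exists_top (F := F) X).choose
  le_top := (OreanForm.exists_top (F := F) X).choose_spec
  bot := (OreanForm.exists_bot (F := F) X).choose
  bot_le := (OreanForm.exists_bot (F := F) X).choose_spec

variable {F : B ⥤ C} [OreanForm F]

/-- The direct image `f · S`, the smallest `T` with `T ≥_f S`. -/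
def direct {X Y : C} (f : X ⟶ Y) (S : Cluster F X) : Cluster F Y :=
  (OreanForm.exists_direct f S).choose

/-- The inverse image `T · f`, the largest `S` with `T ≥_f S`. -/
def inverse {X Y : C} (f : X ⟶ Y) (T : Cluster F Y) : Cluster F X :=
  (OreanForm.exists_inverse f T).choose

variable (F) in
/-- The image of a morphism `f`: the direct image of the top cluster. -/
def im {X Y : C} (f : X ⟶ Y) : Cluster F Y := direct f ⊤

variable (F) in
/-- The kernel of a morphism `f`: the inverse image of the bottom cluster. -/
def ker {X Y : C} (f : X ⟶ Y) : Cluster F X := inverse f ⊥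

theorem direct_le_iff {X Y : C} (f : X ⟶ Y) (S : Cluster F X) (T : Cluster F Y) :
    direct f S ≤ T ↔ Rel F f S T := by
  have hs := (OreanForm.exists_direct f S).choose_spec
  refine ⟨fun h => ?_, fun h => hs.2 h⟩
  have := Rel.comp (show Rel F f S (direct f S) from hs.1) h
  rwa [Category.comp_id] at this

theorem le_inverse_iff {X Y : C} (f : X ⟶ Y) (S : Cluster F X) (T : Cluster F Y) :
    S ≤ inverse f T ↔ Rel F f S T := by
  have hs := (OreanForm.exists_inverse f T).choose_spec
  refine ⟨fun h => ?_, fun h => hs.2 h⟩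
  have := Rel.comp h (show Rel F f (inverse f T) T from hs.1)
  rwa [Category.id_comp] at this

theorem direct_gc {X Y : C} (f : X ⟶ Y) :
    GaloisConnection (direct f : Cluster F X → Cluster F Y) (inverse f) :=
  fun S T => (direct_le_iff f S T).trans (le_inverse_iff f S T).symm

theorem direct_comp {X Y Z : C} (f : X ⟶ Y) (g : Y ⟶ Z) (S : Cluster F X) :
    direct (f ≫ g) S = direct g (direct f S) := by
  apply le_antisymm
  · rw [direct_le_iff]
    exact Rel.comp ((direct_le_iff f S _).1 le_rfl) ((direct_le_iff g _ _).1 le_rfl)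
  · obtain ⟨T, h₁, h₂⟩ := OreanForm.exists_factor f g S _ ((direct_le_iff (f ≫ g) S _).1 le_rfl)
    exact ((direct_gc g).monotone_l ((direct_le_iff _ _ _).2 h₁)).trans ((direct_le_iff _ _ _).2 h₂)

theorem inverse_comp {X Y Z : C} (f : X ⟶ Y) (g : Y ⟶ Z) (T : Cluster F Z) :
    inverse (f ≫ g) T = inverse f (inverse g T) := by
  refine eq_of_forall_le_iff fun S => ?_
  rw [← (direct_gc (f ≫ g)).le_iff_le, ← (direct_gc f).le_iff_le, ← (direct_gc g).le_iff_le,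
    direct_comp]

theorem direct_id {X : C} (S : Cluster F X) : direct (𝟙 X) S = S :=
  eq_of_forall_ge_iff fun _ => direct_le_iff _ _ _

theorem inverse_id {X : C} (S : Cluster F X) : inverse (𝟙 X) S = S :=
  eq_of_forall_le_iff fun _ => le_inverse_iff _ _ _

theorem im_comp {X Y Z : C} (f : X ⟶ Y) (g : Y ⟶ Z) : im F (f ≫ g) = direct g (im F f) :=
  direct_comp f g ⊤

theorem ker_comp {X Y Z : C} (f : X ⟶ Y) (g : Y ⟶ Z) : ker F (f ≫ g) = inverse f (ker F g) :=
  inverse_comp f g ⊥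

theorem im_iso {X Y : C} (f : X ⟶ Y) [IsIso f] : im F f = ⊤ := by
  rw [← top_le_iff]
  calc (⊤ : Cluster F Y) = direct f (direct (inv f) ⊤) := by
        rw [← direct_comp, IsIso.inv_hom_id, direct_id]
    _ ≤ im F f := (direct_gc f).monotone_l le_top

theorem ker_iso {X Y : C} (f : X ⟶ Y) [IsIso f] : ker F f = ⊥ := by
  rw [← le_bot_iff]
  calc ker F f ≤ inverse f (inverse (inv f) ⊥) := (direct_gc f).monotone_u bot_le
    _ = ⊥ := by rw [← inverse_comp, IsIso.hom_inv_id, inverse_id]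

variable (F) in
/-- A form is *conormal* when every cluster is the image of some morphism. -/
def IsConormalForm : Prop :=
  ∀ {X : C} (S : Cluster F X), ∃ (W : C) (f : W ⟶ X), im F f = S

variable (F) in
/-- A form is *normal* when every cluster is the kernel of some morphism. -/
def IsNormalForm : Prop :=
  ∀ {X : C} (S : Cluster F X), ∃ (Y : C) (g : X ⟶ Y), ker F g = S

/-- `f` is an *embedding* of the cluster `S`: its image is `S`, and each morphism whose image is
below `S` factors uniquely through `f`. -/
def IsEmbedding {W X : C} (f : W ⟶ X) (S : Cluster F X) : Prop :=
  im F f = S ∧ ∀ {W' : C} (f' : W' ⟶ X), im F f' ≤ S → ∃! g : W' ⟶ W, g ≫ f = f'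

/-- `g` is a *quotient* of the cluster `S`: its kernel is `S`, and each morphism whose kernel is
above `S` factors uniquely through `g`. -/
def IsQuotient {X Y : C} (g : X ⟶ Y) (S : Cluster F X) : Prop :=
  ker F g = S ∧ ∀ {Y' : C} (g' : X ⟶ Y'), S ≤ ker F g' → ∃! h : Y ⟶ Y', g ≫ h = g'

variable (F) in
/-- A *projection* is a quotient of some cluster (necessarily a kernel). -/
def IsProjection {X Y : C} (g : X ⟶ Y) : Prop := ∃ S : Cluster F X, IsQuotient g S

variable (F) in
/-- The axiom (N1): the join formula and the meet formula. -/
structure SatisfiesN1 : Prop where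
  join : ∀ {X Y : C} (f : X ⟶ Y) (S : Cluster F X), inverse f (direct f S) = S ⊔ ker F f
  meet : ∀ {X Y : C} (f : X ⟶ Y) (T : Cluster F Y), direct f (inverse f T) = T ⊓ im F f

theorem IsEmbedding.mono {W X : C} {f : W ⟶ X} {S : Cluster F X} (h : IsEmbedding f S) :
    Mono f where
  right_cancellation a b hab :=
    (h.2 (a ≫ f) (by rw [im_comp, ← h.1]; exact (direct_gc f).monotone_l le_top)).unique
      rfl hab.symm

theorem IsQuotient.epi {X Y : C} {g : X ⟶ Y} {S : Cluster F X} (h : IsQuotient g S) :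
    Epi g where
  left_cancellation a b hab :=
    (h.2 (g ≫ a) (by rw [ker_comp, ← h.1]; exact (direct_gc g).monotone_u bot_le)).unique
      rfl hab.symm

/-- Two embeddings of the same cluster differ by an isomorphism. -/
theorem IsEmbedding.isIso {W W' X : C} {f : W ⟶ X} {f' : W' ⟶ X} {S : Cluster F X}
    (h : IsEmbedding f S) (h' : IsEmbedding f' S) {e : W' ⟶ W} (he : e ≫ f = f') : IsIso e := by
  obtain ⟨d, hd, -⟩ := h'.2 f h.1.le
  have := h.mono
  have := h'.mono
  refine ⟨d, ?_, ?_⟩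
  · rw [← cancel_mono f', Category.assoc, hd, he, Category.id_comp]
  · rw [← cancel_mono f, Category.assoc, he, hd, Category.id_comp]

/-- Two quotients of the same cluster differ by an isomorphism. -/
theorem IsQuotient.isIso {X Y Y' : C} {g : X ⟶ Y} {g' : X ⟶ Y'} {S : Cluster F X}
    (h : IsQuotient g S) (h' : IsQuotient g' S) {e : Y ⟶ Y'} (he : g ≫ e = g') : IsIso e := by
  obtain ⟨d, hd, -⟩ := h'.2 g h.1.ge
  have := h.epi
  have := h'.epi
  refine ⟨d, ?_, ?_⟩
  · rw [← cancel_epi g, reassoc_of% he, hd, Category.comp_id]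
  · rw [← cancel_epi g', reassoc_of% hd, he, Category.comp_id]

theorem IsEmbedding.iso_comp {W W' X : C} {f : W ⟶ X} {S : Cluster F X}
    (h : IsEmbedding f S) (e : W' ⟶ W) [IsIso e] : IsEmbedding (e ≫ f) S := by
  refine ⟨by rw [im_comp, im_iso]; exact h.1, fun f' hf' => ?_⟩
  obtain ⟨g, hg, hu⟩ := h.2 f' hf'
  refine ⟨g ≫ inv e, by simpa using hg, fun k hk => ?_⟩
  rw [← hu (k ≫ e) (by simpa using hk)]
  simp

theorem IsQuotient.comp_iso {X Y Y' : C} {g : X ⟶ Y} {S : Cluster F X}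
    (h : IsQuotient g S) (e : Y ⟶ Y') [IsIso e] : IsQuotient (g ≫ e) S := by
  refine ⟨by rw [ker_comp, ker_iso]; exact h.1, fun g' hg' => ?_⟩
  obtain ⟨k, hk, hu⟩ := h.2 g' hg'
  refine ⟨inv e ≫ k, by simpa using hk, fun l hl => ?_⟩
  rw [← hu (e ≫ l) (by simpa using hl)]
  simp

theorem isEmbedding_of_isIso {X Y : C} (f : X ⟶ Y) [IsIso f] :
    IsEmbedding f (⊤ : Cluster F Y) :=
  ⟨im_iso f, fun f' _ => ⟨f' ≫ inv f, by simp, fun k hk => by simp [← hk]⟩⟩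

theorem isQuotient_of_isIso {X Y : C} (f : X ⟶ Y) [IsIso f] :
    IsQuotient f (⊥ : Cluster F X) :=
  ⟨ker_iso f, fun f' _ => ⟨inv f ≫ f', by simp, fun k hk => by simp [← hk]⟩⟩

end

end Forms

section Operators

variable {C : Type u₁} [Category.{v₁} C] {A : Type u₂} [Category.{v₂} A]
  {B : Type u₃} [Category.{v₃} B]

/-- An *operator* from `F` to `G`: a functor between the domains commuting with `F` and `G`. -/
structure Operator (F : A ⥤ C) (G : B ⥤ C) where
  functor : A ⥤ B
  comp_eq : functor ⋙ G = F

/-- The action of an operator on clusters. -/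
def Operator.onClusters {F : A ⥤ C} {G : B ⥤ C} (τ : Operator F G) {X : C} (S : Cluster F X) :
    Cluster G X :=
  ⟨τ.functor.obj S.1, (Functor.congr_obj τ.comp_eq S.1).trans S.2⟩

theorem Operator.rel {F : A ⥤ C} {G : B ⥤ C} (τ : Operator F G) {X Y : C} {f : X ⟶ Y}
    {S : Cluster F X} {T : Cluster F Y} (h : Rel F f S T) : Rel G f (τ.onClusters S) (τ.onClusters T) := by
  obtain ⟨φ, hφ⟩ := h
  refine ⟨τ.functor.map φ, ?_⟩
  obtain ⟨H, rfl⟩ := τ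
  obtain ⟨S, rfl⟩ := S
  obtain ⟨T, rfl⟩ := T
  obtain rfl := IsHomLift.eq_of_isHomLift (H ⋙ G) f φ
  exact IsHomLift.map G (H.map φ)

theorem Operator.monotone {F : A ⥤ C} {G : B ⥤ C} [Form F] [Form G] (τ : Operator F G) {X : C} :
    Monotone (τ.onClusters : Cluster F X → Cluster G X) := fun _ _ h => τ.rel h

section

variable {F : A ⥤ C} {G : B ⥤ C} (t : ∀ {X : C}, Cluster F X → Cluster G X)
  (ht : ∀ {X Y : C} (f : X ⟶ Y) (S : Cluster F X) (T : Cluster F Y),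
    Rel F f S T → Rel G f (t S) (t T))

/-- The operator determined by a monotone assignment of clusters to clusters. -/
noncomputable def Operator.ofClusters [G.Faithful] : Operator F G where
  functor :=
    { obj := fun S => (t (X := F.obj S) ⟨S, rfl⟩).1
      map := fun {S T} φ => (ht (F.map φ) ⟨S, rfl⟩ ⟨T, rfl⟩ ⟨φ, IsHomLift.map F φ⟩).choose
      map_id := fun S => lift_unique
        (ht (F.map (𝟙 S)) ⟨S, rfl⟩ ⟨S, rfl⟩ ⟨𝟙 S, IsHomLift.map F (𝟙 S)⟩).choose_spec (by
          rw [F.map_id]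
          exact IsHomLift.id (t (X := F.obj S) ⟨S, rfl⟩).2)
      map_comp := fun {S T U} φ ψ => by
        have h₁ := (ht (F.map φ) ⟨S, rfl⟩ ⟨T, rfl⟩ ⟨φ, IsHomLift.map F φ⟩).choose_spec
        have h₂ := (ht (F.map ψ) ⟨T, rfl⟩ ⟨U, rfl⟩ ⟨ψ, IsHomLift.map F ψ⟩).choose_spec
        refine lift_unique
          (ht (F.map (φ ≫ ψ)) ⟨S, rfl⟩ ⟨U, rfl⟩ ⟨φ ≫ ψ, IsHomLift.map F (φ ≫ ψ)⟩).choose_spec ?_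
        rw [F.map_comp]
        exact IsHomLift.comp G _ _ _ _ }
  comp_eq := by
    refine CategoryTheory.Functor.ext (fun S => (t (X := F.obj S) ⟨S, rfl⟩).2) ?_
    intro S T φ
    have h := (ht (F.map φ) ⟨S, rfl⟩ ⟨T, rfl⟩ ⟨φ, IsHomLift.map F φ⟩).choose_spec
    exact IsHomLift.fac' G _ _

@[simp]
theorem Operator.ofClusters_apply [G.Faithful] {X : C} (S : Cluster F X) :
    (Operator.ofClusters t ht).onClusters S = t S := by
  obtain ⟨S, rfl⟩ := S
  rfl

end

variable {F : A ⥤ C} {G : B ⥤ C} [OreanForm F] [OreanForm G]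

/-- An operator is *conormal* when it preserves images of morphisms. -/
def Operator.IsConormal (τ : Operator F G) : Prop :=
  ∀ {X Y : C} (f : X ⟶ Y), τ.onClusters (im F f) = im G f

/-- An operator is *normal* when it preserves kernels of morphisms. -/
def Operator.IsNormal (τ : Operator F G) : Prop :=
  ∀ {X Y : C} (f : X ⟶ Y), τ.onClusters (ker F f) = ker G f

/-- A conormal operator on a conormal form is unique (on clusters). -/
theorem Operator.IsConormal.unique (hF : IsConormalForm F) {τ σ : Operator F G}
    (hτ : τ.IsConormal) (hσ : σ.IsConormal) {X : C} (S : Cluster F X) :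
    τ.onClusters S = σ.onClusters S := by
  obtain ⟨W, f, rfl⟩ := hF S
  rw [hτ, hσ]

/-- A normal operator on a normal form is unique (on clusters). -/
theorem Operator.IsNormal.unique (hF : IsNormalForm F) {τ σ : Operator F G}
    (hτ : τ.IsNormal) (hσ : σ.IsNormal) {X : C} (S : Cluster F X) :
    τ.onClusters S = σ.onClusters S := by
  obtain ⟨W, f, rfl⟩ := hF S
  rw [hτ, hσ]

end Operators

section Factorizations

variable {C : Type u₁} [Category.{v₁} C] {Bs : Type u₂} [Category.{v₂} Bs]
  {Be : Type u₃} [Category.{v₃} Be]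

/-- An *orean factorization* `(Fs, Fe)` of `C`: a conormal orean form `Fs` and a normal orean form
`Fe` such that each morphism `f` is an `Fe`-quotient of its `Fe`-kernel followed by an
`Fs`-embedding of its `Fs`-image. -/
structure IsOreanFactorization (Fs : Bs ⥤ C) (Fe : Be ⥤ C) [OreanForm Fs] [OreanForm Fe] :
    Prop where
  conormal : IsConormalForm Fs
  normal : IsNormalForm Fe
  factor : ∀ {X Y : C} (f : X ⟶ Y), ∃ (M : C) (e : X ⟶ M) (m : M ⟶ Y),
    IsQuotient e (ker Fe f) ∧ IsEmbedding m (im Fs f) ∧ e ≫ m = f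

namespace IsOreanFactorization

variable {Fs : Bs ⥤ C} {Fe : Be ⥤ C} [OreanForm Fs] [OreanForm Fe]

theorem exists_embedding (h : IsOreanFactorization Fs Fe) {X : C} (A : Cluster Fs X) :
    ∃ (W : C) (m : W ⟶ X), IsEmbedding m A := by
  obtain ⟨V, f, rfl⟩ := h.conormal A
  obtain ⟨M, e, m, -, hm, -⟩ := h.factor f
  exact ⟨M, m, hm⟩

theorem exists_quotient (h : IsOreanFactorization Fs Fe) {X : C} (R : Cluster Fe X) :
    ∃ (Y : C) (e : X ⟶ Y), IsQuotient e R := by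
  obtain ⟨V, f, rfl⟩ := h.normal R
  obtain ⟨M, e, m, he, -, -⟩ := h.factor f
  exact ⟨M, e, he⟩

noncomputable section

/-- The domain of the chosen embedding `ι A`. -/
def sub (h : IsOreanFactorization Fs Fe) {X : C} (A : Cluster Fs X) : C :=
  (h.exists_embedding A).choose

/-- A chosen `Fs`-embedding of the `Fs`-cluster `A`. -/
def ι (h : IsOreanFactorization Fs Fe) {X : C} (A : Cluster Fs X) : h.sub A ⟶ X :=
  (h.exists_embedding A).choose_spec.choose

theorem isEmbedding_ι (h : IsOreanFactorization Fs Fe) {X : C} (A : Cluster Fs X) :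
    IsEmbedding (h.ι A) A := (h.exists_embedding A).choose_spec.choose_spec

/-- The codomain of the chosen quotient `π R`. -/
def quot (h : IsOreanFactorization Fs Fe) {X : C} (R : Cluster Fe X) : C :=
  (h.exists_quotient R).choose

/-- A chosen `Fe`-quotient of the `Fe`-cluster `R`. -/
def π (h : IsOreanFactorization Fs Fe) {X : C} (R : Cluster Fe X) : X ⟶ h.quot R :=
  (h.exists_quotient R).choose_spec.choose

theorem isQuotient_π (h : IsOreanFactorization Fs Fe) {X : C} (R : Cluster Fe X) :
    IsQuotient (h.π R) R := (h.exists_quotient R).choose_spec.choose_spec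

/-- The Wyler join `A ∗ R`: the inverse image of the direct image of `A` along a quotient of `R`. -/
def wyler (h : IsOreanFactorization Fs Fe) {X : C} (A : Cluster Fs X) (R : Cluster Fe X) :
    Cluster Fs X :=
  inverse (h.π R) (direct (h.π R) A)

theorem α_rel (h : IsOreanFactorization Fs Fe) {X Y : C} (f : X ⟶ Y) (A : Cluster Fs X)
    (B : Cluster Fs Y) (hAB : Rel Fs f A B) : Rel Fe f (im Fe (h.ι A)) (im Fe (h.ι B)) := by
  rw [← direct_le_iff] at hAB ⊢
  rw [← im_comp]
  obtain ⟨g, hg, -⟩ := (h.isEmbedding_ι B).2 (h.ι A ≫ f) (by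
    rwa [im_comp, (h.isEmbedding_ι A).1])
  rw [← hg, im_comp]
  exact (direct_gc _).monotone_l le_top

theorem β_rel (h : IsOreanFactorization Fs Fe) {X Y : C} (f : X ⟶ Y) (R : Cluster Fe X)
    (S : Cluster Fe Y) (hRS : Rel Fe f R S) : Rel Fs f (ker Fs (h.π R)) (ker Fs (h.π S)) := by
  rw [← le_inverse_iff] at hRS ⊢
  rw [← ker_comp]
  obtain ⟨g, hg, -⟩ := (h.isQuotient_π R).2 (f ≫ h.π S) (by
    rwa [ker_comp, (h.isQuotient_π S).1])
  rw [← hg, ker_comp]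
  exact (direct_gc _).monotone_u bot_le

/-- The conormal operator `Fs → Fe`, sending `A` to the `Fe`-image of an `Fs`-embedding of `A`. -/
def α (h : IsOreanFactorization Fs Fe) : Operator Fs Fe :=
  Operator.ofClusters (fun A => im Fe (h.ι A)) h.α_rel

/-- The normal operator `Fe → Fs`, sending `R` to the `Fs`-kernel of an `Fe`-quotient of `R`. -/
def β (h : IsOreanFactorization Fs Fe) : Operator Fe Fs :=
  Operator.ofClusters (fun R => ker Fs (h.π R)) h.β_rel

end

theorem α_apply (h : IsOreanFactorization Fs Fe) {X : C} (A : Cluster Fs X) :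
    h.α.onClusters A = im Fe (h.ι A) := Operator.ofClusters_apply _ h.α_rel A

theorem β_apply (h : IsOreanFactorization Fs Fe) {X : C} (R : Cluster Fe X) :
    h.β.onClusters R = ker Fs (h.π R) := Operator.ofClusters_apply _ h.β_rel R

theorem isQuotient_of_im (h : IsOreanFactorization Fs Fe) {X Y : C} (f : X ⟶ Y)
    (hf : im Fs f = ⊤) : IsQuotient f (ker Fe f) := by
  obtain ⟨M, e, m, he, hm, hem⟩ := h.factor f
  have : IsIso m := (isEmbedding_of_isIso (𝟙 Y)).isIso (hf ▸ hm) (Category.comp_id m)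
  have := he.comp_iso m
  rwa [hem] at this

theorem isEmbedding_of_ker (h : IsOreanFactorization Fs Fe) {X Y : C} (f : X ⟶ Y)
    (hf : ker Fe f = ⊥) : IsEmbedding f (im Fs f) := by
  obtain ⟨M, e, m, he, hm, hem⟩ := h.factor f
  have : IsIso e := (isQuotient_of_isIso (𝟙 X)).isIso (hf ▸ he) (Category.id_comp e)
  have := hm.iso_comp e
  rwa [hem] at this

theorem im_eq_top_of_isQuotient (h : IsOreanFactorization Fs Fe) {X Y : C} {f : X ⟶ Y}
    {R : Cluster Fe X} (hf : IsQuotient f R) : im Fs f = ⊤ := by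
  obtain ⟨M, e, m, he, hm, hem⟩ := h.factor f
  have : IsIso m := he.isIso (hf.1 ▸ hf) hem
  rw [← hm.1, im_iso]

theorem ker_eq_bot_of_isEmbedding (h : IsOreanFactorization Fs Fe) {X Y : C} {f : X ⟶ Y}
    {A : Cluster Fs Y} (hf : IsEmbedding f A) : ker Fe f = ⊥ := by
  obtain ⟨M, e, m, he, hm, hem⟩ := h.factor f
  have : IsIso e := hm.isIso (hf.1 ▸ hf) hem
  rw [← he.1, ker_iso]

theorem im_quotient (h : IsOreanFactorization Fs Fe) {X Y : C} {f : X ⟶ Y}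
    {R : Cluster Fe X} (hf : IsQuotient f R) : im Fe f = ⊤ := by
  have hT := h.isQuotient_π (im Fe f)
  have h1 := h.isQuotient_π (⊤ : Cluster Fe Y)
  have hk : ∀ S : Cluster Fe Y, im Fe f ≤ S → ker Fe (f ≫ h.π S) = ⊤ := fun S hS => by
    rw [ker_comp, (h.isQuotient_π S).1, ← top_le_iff, ← (direct_gc f).le_iff_le]
    exact hS
  have hq : IsQuotient (f ≫ h.π (⊤ : Cluster Fe Y)) (⊤ : Cluster Fe X) := by
    rw [← hk ⊤ le_top]
    apply h.isQuotient_of_im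
    rw [im_comp, h.im_eq_top_of_isQuotient hf]
    exact h.im_eq_top_of_isQuotient h1
  obtain ⟨w, hw, -⟩ := hq.2 (f ≫ h.π (im Fe f)) (hk _ le_rfl).ge
  have := hf.epi
  rw [Category.assoc, cancel_epi] at hw
  rw [← hT.1, ← top_le_iff, ← hw, ker_comp]
  calc (⊤ : Cluster Fe Y) = ker Fe (h.π ⊤) := h1.1.symm
    _ ≤ _ := (direct_gc _).monotone_u bot_le

theorem ker_embedding (h : IsOreanFactorization Fs Fe) {X Y : C} {f : X ⟶ Y}
    {A : Cluster Fs Y} (hf : IsEmbedding f A) : ker Fs f = ⊥ := by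
  have hT := h.isEmbedding_ι (ker Fs f)
  have h1 := h.isEmbedding_ι (⊥ : Cluster Fs X)
  have hk : ∀ S : Cluster Fs X, S ≤ ker Fs f → im Fs (h.ι S ≫ f) = ⊥ := fun S hS => by
    rw [im_comp, (h.isEmbedding_ι S).1, ← le_bot_iff, (direct_gc f).le_iff_le]
    exact hS
  have hq : IsEmbedding (h.ι (⊥ : Cluster Fs X) ≫ f) (⊥ : Cluster Fs Y) := by
    rw [← hk ⊥ bot_le]
    apply h.isEmbedding_of_ker
    rw [ker_comp, h.ker_eq_bot_of_isEmbedding hf]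
    exact h.ker_eq_bot_of_isEmbedding h1
  obtain ⟨w, hw, -⟩ := hq.2 (h.ι (ker Fs f) ≫ f) (hk _ le_rfl).le
  have := hf.mono
  rw [← Category.assoc, cancel_mono] at hw
  rw [← hT.1, ← le_bot_iff, ← hw, im_comp]
  calc _ ≤ im Fs (h.ι ⊥) := (direct_gc _).monotone_l le_top
    _ = ⊥ := h1.1

/-- `α` is a conormal operator. -/
theorem α_isConormal (h : IsOreanFactorization Fs Fe) : h.α.IsConormal := by
  intro X Y f
  obtain ⟨M, e, m, he, hm, hem⟩ := h.factor f
  obtain ⟨k, hk, -⟩ := (h.isEmbedding_ι (im Fs f)).2 m hm.1.le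
  have : IsIso k := (h.isEmbedding_ι (im Fs f)).isIso hm hk
  have h1 : im Fe f = im Fe m := by rw [← hem, im_comp, h.im_quotient he]; rfl
  rw [α_apply, h1, ← hk, im_comp k, im_iso k]
  rfl

/-- `β` is a normal operator. -/
theorem β_isNormal (h : IsOreanFactorization Fs Fe) : h.β.IsNormal := by
  intro X Y f
  obtain ⟨M, e, m, he, hm, hem⟩ := h.factor f
  obtain ⟨k, hk, -⟩ := (h.isQuotient_π (ker Fe f)).2 e he.1.ge
  have : IsIso k := (h.isQuotient_π (ker Fe f)).isIso he hk
  have h1 : ker Fs f = ker Fs e := by rw [← hem, ker_comp, h.ker_embedding hm]; rfl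
  rw [β_apply, h1, ← hk, ker_comp _ k, ker_iso k]
  rfl

end IsOreanFactorization

end Factorizations

end OreanForms

open OreanForms

namespace OreanForms

section

variable {C : Type u₁} [Category.{v₁} C] {B : Type u₂} [Category.{v₂} B] {F : B ⥤ C}
  [OreanForm F]

/-- A cluster below the image of an embedding is the direct image of its inverse image. -/
theorem IsEmbedding.direct_inverse {M Y : C} {m : M ⟶ Y} {S : Cluster F Y}
    (hm : IsEmbedding m S) {W : C} {i : W ⟶ Y} (hi : im F i ≤ S) :
    direct m (inverse m (im F i)) = im F i := by
  obtain ⟨g, rfl, -⟩ := hm.2 i hi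
  rw [im_comp]
  exact (direct_gc m).l_u_l_eq_l _

theorem isProjection_id (X : C) : IsProjection F (𝟙 X) :=
  ⟨⊥, isQuotient_of_isIso (𝟙 X)⟩

end

namespace IsOreanFactorization

variable {C : Type u₁} [Category.{v₁} C] {Bs : Type u₂} [Category.{v₂} Bs]
  {Be : Type u₃} [Category.{v₃} Be] {Fs : Bs ⥤ C} {Fe : Be ⥤ C} [OreanForm Fs] [OreanForm Fe]
  (h : IsOreanFactorization Fs Fe)

theorem le_wyler_iff {X : C} (A A' : Cluster Fs X) (R : Cluster Fe X) :
    A' ≤ h.wyler A R ↔ direct (h.π R) A' ≤ direct (h.π R) A :=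
  ((direct_gc (h.π R)).le_iff_le).symm

theorem wyler_mono {X : C} {A A' : Cluster Fs X} (hA : A ≤ A') (R : Cluster Fe X) :
    h.wyler A R ≤ h.wyler A' R :=
  (direct_gc (h.π R)).monotone_u ((direct_gc (h.π R)).monotone_l hA)

/-- Relations `S ≥_f R` carry Wyler joins forward along direct images. -/
theorem direct_le_wyler {X Y : C} {f : X ⟶ Y} {A A' : Cluster Fs X} {R : Cluster Fe X}
    {S : Cluster Fe Y} (hRS : Rel Fe f R S) (hA : A' ≤ h.wyler A R) :
    direct f A' ≤ h.wyler (direct f A) S := by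
  rw [← le_inverse_iff] at hRS
  obtain ⟨k, hk, -⟩ := (h.isQuotient_π R).2 (f ≫ h.π S) (by
    rwa [ker_comp, (h.isQuotient_π S).1])
  rw [le_wyler_iff] at hA ⊢
  rw [← direct_comp, ← direct_comp, ← hk, direct_comp, direct_comp]
  exact (direct_gc k).monotone_l hA

theorem α_bot (hαβ : ∀ {X : C} (R : Cluster Fe X), h.α.onClusters (h.β.onClusters R) ≤ R)
    (X : C) : h.α.onClusters (⊥ : Cluster Fs X) = ⊥ :=
  le_bot_iff.1 ((h.α.monotone bot_le).trans (hαβ ⊥))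

theorem α_β_le (hα : ∀ X : C, h.α.onClusters (⊥ : Cluster Fs X) = ⊥) {X : C}
    (R : Cluster Fe X) : h.α.onClusters (h.β.onClusters R) ≤ R := by
  have hrel := h.α.rel ((le_inverse_iff (h.π R) (ker Fs (h.π R)) ⊥).1 le_rfl)
  rw [hα, ← le_inverse_iff] at hrel
  rw [β_apply]
  exact hrel.trans (h.isQuotient_π R).1.le

/-- Recovering `A` from `f · (A · f)` for projections `f` implies recovering it for all `f`. -/
theorem wyler_direct_inverse
    (hproj : ∀ {X Y : C} (e : X ⟶ Y), IsProjection Fe e → ∀ A : Cluster Fs Y,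
      h.wyler (direct e (inverse e A)) (h.α.onClusters A) = A)
    {X Y : C} (f : X ⟶ Y) {A : Cluster Fs Y} {R : Cluster Fe Y} (hAR : h.wyler A R = A)
    (hR : h.α.onClusters A ≤ R) (hA : A ≤ im Fs f) :
    h.wyler (direct f (inverse f A)) R = A := by
  apply le_antisymm
  · exact (h.wyler_mono ((direct_gc f).l_u_le A) R).trans hAR.le
  · obtain ⟨M, e, m, he, hm, rfl⟩ := h.factor f
    have hmA : direct m (inverse m A) = A := by
      have hι := (h.isEmbedding_ι A).1
      have := hm.direct_inverse (i := h.ι A) (hι.trans_le hA)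
      rwa [hι] at this
    have hrel : Rel Fe m (h.α.onClusters (inverse m A)) R := by
      rw [← direct_le_iff]
      exact ((direct_le_iff _ _ _).2 (h.α.rel ((le_inverse_iff m _ A).1 le_rfl))).trans hR
    have := h.direct_le_wyler hrel (hproj e ⟨_, he⟩ (inverse m A)).ge
    rwa [hmA, ← inverse_comp, ← direct_comp] at this

end IsOreanFactorization

end OreanForms

theorem mainTheorem2 {C : Type u₁} [Category.{v₁} C]
    {Bs : Type u₂} [Category.{v₂} Bs] {Be : Type u₃} [Category.{v₃} Be]
    (Fs : Bs ⥤ C) (Fe : Be ⥤ C) [OreanForm Fs] [OreanForm Fe]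
    (h : IsOreanFactorization Fs Fe) :
    ((SatisfiesN1 Fe ∧
        ∀ {X Y : C} (f : X ⟶ Y) (A : Cluster Fs Y) (R : Cluster Fe Y),
          h.wyler A R = A → h.α.onClusters A ≤ R → A ≤ im Fs f → R ≤ im Fe f →
            h.wyler (direct f (inverse f A)) R = A) ∧
      ((∀ {X : C} (A A' : Cluster Fs X), h.α.onClusters (A ⊓ A') = h.α.onClusters A ⊓ h.α.onClusters A') ∧
        (∀ {X : C} (A : Cluster Fs X), A = h.wyler A (h.α.onClusters A)) ∧
        (∀ {X : C} (R : Cluster Fe X), h.α.onClusters (h.β.onClusters R) ≤ R))) ↔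
    ((SatisfiesN1 Fe ∧
        ∀ {X Y : C} (e : X ⟶ Y), IsProjection Fe e → ∀ A : Cluster Fs Y,
          h.wyler (direct e (inverse e A)) (h.α.onClusters A) = h.wyler A (h.α.onClusters A) ∧
            h.wyler A (h.α.onClusters A) = A) ∧
      ((∀ {X : C} (A A' : Cluster Fs X), h.α.onClusters (A ⊓ A') = h.α.onClusters A ⊓ h.α.onClusters A') ∧
        (∀ X : C, h.α.onClusters (⊥ : Cluster Fs X) = ⊥))) := by
  constructor
  · rintro ⟨⟨hN, hi⟩, hmeet, hw, hαβ⟩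
    refine ⟨⟨hN, fun e ⟨S, he⟩ A => ⟨?_, (hw A).symm⟩⟩, hmeet, h.α_bot hαβ⟩
    rw [← hw A]
    exact hi e A _ (hw A).symm le_rfl (le_top.trans (h.im_eq_top_of_isQuotient he).ge)
      (le_top.trans (h.im_quotient he).ge)
  · rintro ⟨⟨hN, hi⟩, hmeet, hbot⟩
    exact ⟨⟨hN, fun f A R hAR hR hA _ => h.wyler_direct_inverse
        (fun e he A => (hi e he A).1.trans (hi e he A).2) f hAR hR hA⟩,
      hmeet, fun A => (hi (𝟙 _) (isProjection_id _) A).2.symm, fun R => h.α_β_le hbot R⟩
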